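/- Let $(X,d)$ be a compact metric space and $f:X\to X$ a homeomorphism. A Borel measure is a non-negative $\sigma$-additive measure on the Borel $\sigma$-algebra; for an arbitrary set $B$, "$\nu(B)=0$" means that $\nu(A)=0$ for every Borel set $A\subset B$. A Borel measure $\mu$ on $X$ is *expansive for $f$* if there is $\delta>0$ such that for every $x\in X$ one has $\mu(\{y\in X: d(f^n(x),f^n(y))\le\delta\ \ \forall n\in\mathbb Z\})=0$. A Borel measure $\nu$ on a metric space $(Y,\rho)$ is *expansive for a flow $\phi$ on $Y$* if there is $\delta>0$ such that $\nu(\Gamma_\delta(y))=0$ for every $y\in Y$, where $\Gamma_\delta(y)$ is the set of all $z\in Y$ for which there is a continuous $h:\mathbb R\to\mathbb R$ with $h(0)=0$ and $\rho(\phi_t(y),\phi_{h(t)}(z))\le\delta$ for all $t\in\mathbb R$. For a continuous $\tau:X\to(0,\infty)$ let $Y^{\tau,f}$ be the quotient of $\{(x,t)\in X\times\mathbb R:0\le t\le\tau(x)\}$ by the equivalence relation generated by $(x,\tau(x))\sim(f(x),0)$, with the quotient topology. The *suspension flow* over $f$ with height function $\tau$ is $\phi^{\tau,f}_t(x,s)=(x,t+s)$,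 where for arbitrary real $u$ the symbol $(x,u)$ is read through the identifications $(x,u+\tau(x))=(f(x),u)$. The space $Y^{\tau,f}$ carries the Bowen-Walters metric $d^{\tau,f}$. For $\tau=1$, $d^{1,f}(y,z)$ is the infimum of the lengths of finite chains of segments from $y$ to $z$. A horizontal segment joins $(x,t)$ to $(x',t)$, with $0\le t\le1$, and has length $(1-t)\,d_0(x,x')+t\,d_0(f(x),f(x'))$, where $d_0=d/\operatorname{diam}(X)$ (and $d_0=0$ if $\operatorname{diam}(X)=0$). A vertical segment joins $y$ to $\phi^{1,f}_r(y)$, $r\in\mathbb R$, and has length $|r|$. For general $\tau$, $d^{\tau,f}(y,z)=d^{1,f}(\lambda(y),\lambda(z))$ with $\lambda(x,t)=(x,t/\tau(x))$. For a Borel measure $\mu$ on $X$ the *lifted measure* $T^{\tau,f}(\mu)$ is the Borel measure on $Y^{\tau,f}$ given by $$\int_{Y^{\tau,f}}h\,dT^{\tau,f}(\mu)=\int_X\frac1{\tau(x)}\int_0^{\tau(x)}h\big(\phi^{\tau,f}_t(x,0)\big)\,dt\,d\mu(x)$$ for all Borel functions $h:Y^{\tau,f}\to[0,\infty]$ (hence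 also, if $\mu$ is finite, for all continuous $h:Y^{\tau,f}\to\mathbb R$). **Theorem.** Let $f:X\to X$ be a homeomorphism of a compact metric space $X$. A Borel measure $\mu$ on $X$ is expansive for $f$ if and only if there is a continuous map $\tau:X\to(0,\infty)$ such that $T^{\tau,f}(\mu)$ is expansive for the suspension flow over $f$ with height function $\tau$. -/

import Mathlib

open MeasureTheory
open scoped ENNReal

/-- A subset `B`, measurable or not, has measure zero if every measurable subset of `B` does. -/
def InnerNull {Y : Type*} [MeasurableSpace Y] (ν : Measure Y) (B : Set Y) : Prop :=
  ∀ A : Set Y, MeasurableSet A → A ⊆ B → ν A = 0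

section Homeo

variable {X : Type*} [MetricSpace X]

/-- The dynamic ball of `f` around `x`. -/
def dynBall (f : X ≃ₜ X) (δ : ℝ) (x : X) : Set X :=
  {y | ∀ n : ℤ, dist ((f ^ n) x) ((f ^ n) y) ≤ δ}

/-- `μ` is an expansive measure of the homeomorphism `f`. -/
def IsExpansiveMeasure [MeasurableSpace X] (f : X ≃ₜ X) (μ : Measure X) : Prop :=
  ∃ δ : ℝ, 0 < δ ∧ ∀ x : X, InnerNull μ (dynBall f δ x)

end Homeo

section Flow

/-- The set `Γ_δ(x)` of a flow `φ`: the union over the continuous `h : ℝ → ℝ` with `h 0 = 0` of the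
sets of all `y` such that `φ_{h(t)}(y)` is in the closed ball `B[φ_t(x), δ]` for all `t`. -/
def flowBall {Y : Type*} [Dist Y] (φ : ℝ → Y → Y) (δ : ℝ) (x : Y) : Set Y :=
  {y | ∃ h : ℝ → ℝ, Continuous h ∧ h 0 = 0 ∧ ∀ t : ℝ, dist (φ t x) (φ (h t) y) ≤ δ}

/-- `ν` is an expansive measure of the flow `φ`. -/
def IsFlowExpansiveMeasure {Y : Type*} [Dist Y] [MeasurableSpace Y]
    (φ : ℝ → Y → Y) (ν : Measure Y) : Prop :=
  ∃ δ : ℝ, 0 < δ ∧ ∀ x : Y, InnerNull ν (flowBall φ δ x)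

end Flow

section Suspension

variable {X : Type*} [MetricSpace X]

/-- The region `{(x, t) : 0 ≤ t ≤ τ x}` under the graph of the height function. -/
abbrev UnderRoof (τ : C(X, Set.Ioi (0 : ℝ))) : Type _ :=
  {p : X × ℝ // 0 ≤ p.2 ∧ p.2 ≤ (τ p.1 : ℝ)}

/-- The identification of `(x, τ x)` with `(f x, 0)`. -/
def RoofRel (f : X ≃ₜ X) (τ : C(X, Set.Ioi (0 : ℝ))) (p q : UnderRoof τ) : Prop :=
  p.1.2 = (τ p.1.1 : ℝ) ∧ q.1 = (f p.1.1, 0)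

/-- The suspension space: the quotient of the region under the graph of `τ` by the equivalence
relation that `RoofRel f τ` generates. -/
def Suspension (f : X ≃ₜ X) (τ : C(X, Set.Ioi (0 : ℝ))) : Type _ := Quot (RoofRel f τ)

variable (f : X ≃ₜ X) (τ : C(X, Set.Ioi (0 : ℝ)))

/-- The quotient topology. -/
instance Suspension.instTopologicalSpace : TopologicalSpace (Suspension f τ) :=
  inferInstanceAs (TopologicalSpace (Quot (RoofRel f τ)))

/-- The Borel sigma-algebra. -/
instance Suspension.instMeasurableSpace : MeasurableSpace (Suspension f τ) :=
  borel (Suspension f τ)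

instance Suspension.instBorelSpace : BorelSpace (Suspension f τ) := ⟨rfl⟩

/-- The class of a point under the roof. -/
def Suspension.mk (p : UnderRoof τ) : Suspension f τ := Quot.mk (RoofRel f τ) p

theorem Suspension.continuous_mk : Continuous (Suspension.mk f τ) := continuous_quot_mk

/-- A continuous map that agrees with `(x, t) ↦ φ_t(x)` for `0 ≤ t ≤ τ x`. -/
def Suspension.clampMap (p : X × ℝ) : Suspension f τ :=
  mk f τ ⟨(p.1, max 0 (min p.2 (τ p.1))), le_max_left _ _,
    max_le (τ p.1).2.le (min_le_right _ _)⟩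

theorem Suspension.continuous_clampMap : Continuous (clampMap f τ) := by
  refine (continuous_mk f τ).comp (Continuous.subtype_mk ?_ _)
  fun_prop

/-- The signed Birkhoff sum of `τ` along the orbit of `x`: the time at which the vertical orbit of
`(x, 0)` reaches `(f ^ n x, 0)`. -/
noncomputable def roofSum (x : X) (n : ℤ) : ℝ :=
  ∑ k ∈ Finset.Ico 0 n, (τ ((f ^ k) x) : ℝ) - ∑ k ∈ Finset.Ico n 0, (τ ((f ^ k) x) : ℝ)

theorem roofSum_zero (x : X) : roofSum f τ x 0 = 0 := by simp [roofSum]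

theorem roofSum_succ (x : X) (n : ℤ) :
    roofSum f τ x (n + 1) = roofSum f τ x n + τ ((f ^ n) x) := by
  unfold roofSum
  rcases le_or_gt 0 n with h | h
  · rw [Finset.Ico_eq_empty (a := n) (b := 0) (by omega),
      Finset.Ico_eq_empty (a := n + 1) (b := 0) (by omega),
      ← Finset.insert_Ico_right_eq_Ico_add_one h, Finset.sum_insert (by simp)]
    simp [add_comm]
  · rw [Finset.Ico_eq_empty (a := 0) (b := n) (by omega),
      Finset.Ico_eq_empty (a := 0) (b := n + 1) (by omega),
      ← Finset.insert_Ico_add_one_left_eq_Ico h, Finset.sum_insert (by simp)]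
    simp

theorem roofSum_map (x : X) (n : ℤ) :
    roofSum f τ (f x) n = roofSum f τ x (n + 1) - τ x := by
  have key : ∀ m : ℤ, (f ^ m) (f x) = (f ^ (m + 1)) x := fun m => by
    rw [zpow_add_one]; rfl
  induction n using Int.induction_on with
  | zero =>
    have h := roofSum_succ f τ x 0
    rw [roofSum_zero] at h
    rw [roofSum_zero, h]
    simp
  | succ i ih => rw [roofSum_succ, ih, roofSum_succ f τ x (i + 1), key]; ring
  | pred i ih =>
    have h1 := roofSum_succ f τ (f x) (-(i : ℤ) - 1)
    have h2 := roofSum_succ f τ x (-(i : ℤ) - 1 + 1)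
    rw [key] at h1
    simp only [sub_add_cancel] at h1 h2 ⊢
    linarith

theorem roofSum_strictMono (x : X) : StrictMono (roofSum f τ x) := by
  refine strictMono_int_of_lt_succ fun n => ?_
  rw [roofSum_succ]
  have := (τ ((f ^ n) x)).2
  simp only [Set.mem_Ioi] at this
  linarith

theorem exists_lap [CompactSpace X] (x : X) (s : ℝ) :
    ∃ n : ℤ, roofSum f τ x n ≤ s ∧ s < roofSum f τ x (n + 1) := by
  obtain ⟨c, hc, hτ⟩ : ∃ c : ℝ, 0 < c ∧ ∀ z, c ≤ (τ z : ℝ) := by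
    obtain ⟨z, -, hz⟩ := isCompact_univ.exists_isMinOn (⟨x, trivial⟩ : (Set.univ : Set X).Nonempty)
      (f := fun z => (τ z : ℝ)) (by fun_prop)
    exact ⟨τ z, (τ z).2, fun w => hz (Set.mem_univ w)⟩
  have hpos : ∀ n : ℕ, n * c ≤ roofSum f τ x n := by
    intro n
    induction n with
    | zero => simp [roofSum_zero]
    | succ n ih =>
      have := roofSum_succ f τ x n
      have := hτ ((f ^ (n : ℤ)) x)
      push_cast
      linarith
  have hneg : ∀ n : ℕ, roofSum f τ x (-n) ≤ -(n * c) := by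
    intro n
    induction n with
    | zero => simp [roofSum_zero]
    | succ n ih =>
      have h1 := roofSum_succ f τ x (-(n : ℤ) - 1)
      have h2 := hτ ((f ^ (-(n : ℤ) - 1)) x)
      rw [sub_add_cancel] at h1
      push_cast
      rw [show -((n : ℤ) + 1) = -(n : ℤ) - 1 by ring]
      linarith
  obtain ⟨N, hN⟩ := exists_nat_gt (|s| / c)
  have hN' : |s| < N * c := by rwa [div_lt_iff₀ hc] at hN
  have h1 := hpos N
  have h2 := hneg N
  have hs := abs_le.1 (le_refl |s|)
  obtain ⟨n, hn, hmax⟩ := Int.exists_greatest_of_bdd (P := fun n => roofSum f τ x n ≤ s)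
    ⟨N, fun z hz => (roofSum_strictMono f τ x).le_iff_le.1 (by linarith)⟩
    ⟨-(N : ℤ), by linarith⟩
  refine ⟨n, hn, ?_⟩
  by_contra! h
  have := hmax (n + 1) h
  omega

variable [CompactSpace X]

/-- The number of laps that the vertical orbit of `(x, 0)` has completed at time `s`. -/
noncomputable def lap (x : X) (s : ℝ) : ℤ := (exists_lap f τ x s).choose

theorem roofSum_lap_le (x : X) (s : ℝ) : roofSum f τ x (lap f τ x s) ≤ s :=
  (exists_lap f τ x s).choose_spec.1

theorem lt_roofSum_lap (x : X) (s : ℝ) : s < roofSum f τ x (lap f τ x s + 1) :=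
  (exists_lap f τ x s).choose_spec.2

theorem lap_eq {x : X} {s : ℝ} {n : ℤ} (h : roofSum f τ x n ≤ s)
    (h' : s < roofSum f τ x (n + 1)) : lap f τ x s = n := by
  have h1 := (roofSum_strictMono f τ x).lt_iff_lt.1 ((roofSum_lap_le f τ x s).trans_lt h')
  have h2 := (roofSum_strictMono f τ x).lt_iff_lt.1 (h.trans_lt (lt_roofSum_lap f τ x s))
  omega

namespace Suspension

/-- The point of the suspension denoted `(x, s)`, for an arbitrary real `s`: with `n` the number of
completed laps it is the class of `(f ^ n x, s - roofSum f τ x n)`. -/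
noncomputable def point (x : X) (s : ℝ) : Suspension f τ :=
  mk f τ ⟨((f ^ lap f τ x s) x, s - roofSum f τ x (lap f τ x s)),
    sub_nonneg.2 (roofSum_lap_le f τ x s), by
      have := lt_roofSum_lap f τ x s
      rw [roofSum_succ] at this
      simp only
      linarith⟩

theorem point_map (x : X) (s : ℝ) : point f τ (f x) s = point f τ x (s + τ x) := by
  have hl : lap f τ x (s + τ x) = lap f τ (f x) s + 1 := by
    have h1 := roofSum_lap_le f τ (f x) s
    have h2 := lt_roofSum_lap f τ (f x) s
    rw [roofSum_map] at h1 h2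
    exact lap_eq f τ (by linarith) (by linarith)
  unfold point
  congr 2
  rw [hl, roofSum_map, zpow_add_one]
  exact Prod.ext rfl (by simp only; ring)

theorem mk_eq_point (p : UnderRoof τ) : mk f τ p = point f τ p.1.1 p.1.2 := by
  obtain ⟨⟨x, s⟩, h0, h1⟩ := p
  simp only at h0 h1
  have base : ∀ (z : X) (u : ℝ) (h : 0 ≤ u) (h' : u < τ z),
      mk f τ ⟨(z, u), h, h'.le⟩ = point f τ z u := by
    intro z u h h'
    have hl : lap f τ z u = 0 :=
      lap_eq f τ (by rwa [roofSum_zero]) (by rw [roofSum_succ, roofSum_zero]; simpa using h')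
    unfold point
    congr 2
    rw [hl, roofSum_zero]
    simp
  rcases h1.lt_or_eq with h | h
  · exact base x s h0 h
  · have e : mk f τ ⟨(x, s), h0, h1⟩ = mk f τ ⟨(f x, 0), le_rfl, (τ (f x)).2.le⟩ :=
      Quot.sound ⟨h, rfl⟩
    rw [e, base (f x) 0 le_rfl (τ (f x)).2, point_map, zero_add]
    exact congrArg (point f τ x) h.symm

/-- The suspension flow `φ_t(x, s) = (x, t + s)`. -/
noncomputable def flow (t : ℝ) : Suspension f τ → Suspension f τ :=
  Quot.lift (fun p : UnderRoof τ => point f τ p.1.1 (t + p.1.2)) (by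
    rintro ⟨⟨x, s⟩, hs⟩ ⟨⟨y, u⟩, hu⟩ ⟨h1, h2⟩
    simp only [Prod.mk.injEq] at h1 h2
    obtain ⟨rfl, rfl⟩ := h2
    simp only
    rw [point_map, h1, add_zero])

theorem flow_mk (t : ℝ) (p : UnderRoof τ) :
    flow f τ t (mk f τ p) = point f τ p.1.1 (t + p.1.2) := rfl

theorem point_zpow (x : X) (n : ℤ) (s : ℝ) :
    point f τ ((f ^ n) x) s = point f τ x (s + roofSum f τ x n) := by
  induction n using Int.induction_on generalizing s with
  | zero => simp [roofSum_zero]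
  | succ i ih =>
    rw [roofSum_succ, add_comm (i : ℤ) 1, zpow_add, zpow_one]
    change point f τ (f ((f ^ (i : ℤ)) x)) s = _
    rw [point_map, ih]
    congr 1
    ring
  | pred i ih =>
    have h := ih (s - τ ((f ^ (-(i : ℤ) - 1)) x))
    have e : (f ^ (-(i : ℤ))) x = f ((f ^ (-(i : ℤ) - 1)) x) := by
      conv_lhs => rw [show -(i : ℤ) = 1 + (-(i : ℤ) - 1) by ring, zpow_add, zpow_one]
      rfl
    have h1 := roofSum_succ f τ x (-(i : ℤ) - 1)
    rw [sub_add_cancel] at h1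
    rw [e, point_map, sub_add_cancel, h1] at h
    rw [h]
    congr 1
    ring

theorem flow_point (t : ℝ) (x : X) (s : ℝ) :
    flow f τ t (point f τ x s) = point f τ x (t + s) := by
  change point f τ ((f ^ lap f τ x s) x) (t + (s - roofSum f τ x (lap f τ x s))) = _
  rw [point_zpow]
  congr 1
  ring

theorem flow_zero (y : Suspension f τ) : flow f τ 0 y = y := by
  induction y using Quot.ind with
  | mk p =>
    change flow f τ 0 (mk f τ p) = mk f τ p
    rw [flow_mk, zero_add, mk_eq_point]

theorem flow_add (s t : ℝ) (y : Suspension f τ) :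
    flow f τ (s + t) y = flow f τ s (flow f τ t y) := by
  induction y using Quot.ind with
  | mk p =>
    change flow f τ (s + t) (mk f τ p) = flow f τ s (flow f τ t (mk f τ p))
    rw [flow_mk, flow_mk, flow_point, add_assoc]

/-- The constant height function `1`. -/
def unitRoof (X : Type*) [MetricSpace X] : C(X, Set.Ioi (0 : ℝ)) :=
  ContinuousMap.const X ⟨1, Set.mem_Ioi.2 one_pos⟩

/-- The metric of `X` divided by the diameter of `X`. -/
noncomputable def normDist (x y : X) : ℝ := dist x y / Metric.diam (Set.univ : Set X)

/-- `Chain f y z l`: the points `y` and `z` of the suspension with height `1` are joined by a finite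
chain of total length `l`. A horizontal segment joins `(x, t)` to `(x', t)`, `0 ≤ t ≤ 1`, and has
length `(1 - t) d(x, x') + t d(f x, f x')`. A vertical segment runs for a time `r` of either sign
along an orbit and has length `|r|`. -/
inductive Chain (f : X ≃ₜ X) :
    Suspension f (unitRoof X) → Suspension f (unitRoof X) → ℝ → Prop
  | nil (y : Suspension f (unitRoof X)) : Chain f y y 0
  | horizontal (x x' : X) (t : ℝ) (h0 : 0 ≤ t) (h1 : t ≤ 1) (z : Suspension f (unitRoof X)) (l : ℝ)
      (c : Chain f (mk f (unitRoof X) ⟨(x', t), h0, h1⟩) z l) :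
      Chain f (mk f (unitRoof X) ⟨(x, t), h0, h1⟩) z
        ((1 - t) * normDist x x' + t * normDist (f x) (f x') + l)
  | vertical (y : Suspension f (unitRoof X)) (r : ℝ) (z : Suspension f (unitRoof X)) (l : ℝ)
      (c : Chain f (flow f (unitRoof X) r y) z l) : Chain f y z (|r| + l)

/-- The Bowen-Walters metric for the height `1`: the infimum of the lengths of the chains. -/
noncomputable def unitDist (y z : Suspension f (unitRoof X)) : ℝ := sInf {l : ℝ | Chain f y z l}

/-- The natural map `(x, t) ↦ (x, t / τ x)` onto the suspension with height `1`. -/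
noncomputable def toUnit : Suspension f τ → Suspension f (unitRoof X) :=
  Quot.lift (fun p : UnderRoof τ => mk f (unitRoof X) ⟨(p.1.1, p.1.2 / τ p.1.1),
      div_nonneg p.2.1 (τ p.1.1).2.le, (div_le_one (τ p.1.1).2).2 p.2.2⟩) (by
    rintro ⟨⟨x, s⟩, hs⟩ ⟨⟨y, u⟩, hu⟩ ⟨h1, h2⟩
    simp only [Prod.mk.injEq] at h1 h2
    obtain ⟨rfl, rfl⟩ := h2
    refine Quot.sound ⟨?_, ?_⟩
    · simp only [h1]
      exact div_self (τ x).2.ne'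
    · simp)

/-- The Bowen-Walters metric on the suspension with height `τ`. -/
noncomputable instance instDist : Dist (Suspension f τ) :=
  ⟨fun y z => unitDist f (toUnit f τ y) (toUnit f τ z)⟩

/-- The point `x` of `X`, regarded as the point `(x, 0)` of the suspension. -/
def base (x : X) : Suspension f τ := mk f τ ⟨(x, 0), le_rfl, (τ x).2.le⟩

theorem flow_base_eq (x : X) {t : ℝ} (ht : t ∈ Set.Icc (0 : ℝ) (τ x)) :
    flow f τ t (base f τ x) = clampMap f τ (x, t) := by
  unfold base clampMap
  rw [flow_mk, mk_eq_point]
  simp [min_eq_left ht.2, max_eq_right ht.1]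

instance instCompactSpace : CompactSpace (Suspension f τ) := by
  obtain ⟨M, hM⟩ := isCompact_univ.exists_bound_of_continuousOn
    (f := fun x : X => (τ x : ℝ)) (by fun_prop)
  have hc : IsCompact (clampMap f τ '' (Set.univ ×ˢ Set.Icc (0 : ℝ) M)) :=
    (isCompact_univ.prod isCompact_Icc).image (continuous_clampMap f τ)
  refine ⟨hc.of_isClosed_subset isClosed_univ fun y _ => ?_⟩
  induction y using Quot.ind with
  | mk p =>
    refine ⟨p.1, ⟨trivial, p.2.1, p.2.2.trans ((le_abs_self _).trans (hM _ trivial))⟩, ?_⟩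
    unfold clampMap mk
    congr 1
    exact Subtype.ext (Prod.ext rfl (by simp [min_eq_left p.2.2, max_eq_right p.2.1]))

theorem aemeasurable_flow_base (x : X) :
    AEMeasurable (fun t : ℝ => flow f τ t (base f τ x))
      (volume.restrict (Set.Icc (0 : ℝ) (τ x))) :=
  ⟨fun t => clampMap f τ (x, t), ((continuous_clampMap f τ).comp (by fun_prop)).measurable,
    (ae_restrict_iff' measurableSet_Icc).2 (.of_forall fun _ ht => flow_base_eq f τ x ht)⟩

/-- The measure on the orbit segment over `x`: the image under `t ↦ φ_t(x)` of the normalized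
Lebesgue measure of `[0, τ x]`. -/
noncomputable def fiberMeasure (x : X) : Measure (Suspension f τ) :=
  (ENNReal.ofReal (τ x : ℝ))⁻¹ •
    (volume.restrict (Set.Icc (0 : ℝ) (τ x))).map (fun t => flow f τ t (base f τ x))

theorem lintegral_fiberMeasure {h : Suspension f τ → ℝ≥0∞} (hh : Measurable h) (x : X) :
    ∫⁻ y, h y ∂fiberMeasure f τ x =
      (ENNReal.ofReal (τ x : ℝ))⁻¹ *
        ∫⁻ t in Set.Icc (0 : ℝ) (τ x), h (flow f τ t (base f τ x)) := by
  rw [fiberMeasure, lintegral_smul_measure,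
    lintegral_map' hh.aemeasurable (aemeasurable_flow_base f τ x), smul_eq_mul]

variable [MeasurableSpace X] [BorelSpace X]

/-- The lifted measure `T^{τ,f}(μ)`, the integral of the measures `fiberMeasure f τ x` with respect
to `μ`. It is characterized by `lintegral_lift`; see also `integral_lift`. -/
noncomputable def lift (μ : Measure X) : Measure (Suspension f τ) := μ.bind (fiberMeasure f τ)


theorem measurable_fiberMeasure : Measurable (fiberMeasure f τ) := by
  have hτ : Measurable fun x : X => (τ x : ℝ) := Continuous.measurable (by fun_prop)
  refine Measure.measurable_of_measurable_coe _ fun s hs => ?_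
  have e : ∀ x, fiberMeasure f τ x s = (ENNReal.ofReal (τ x : ℝ))⁻¹ *
      ∫⁻ t, ({p : X × ℝ | 0 ≤ p.2 ∧ p.2 ≤ τ p.1}.indicator
        (fun p => s.indicator 1 (clampMap f τ p)) (x, t) : ℝ≥0∞) := by
    intro x
    rw [← lintegral_indicator_one hs, lintegral_fiberMeasure f τ (measurable_one.indicator hs),
      ← lintegral_indicator measurableSet_Icc]
    congr 1
    refine lintegral_congr fun t => ?_
    by_cases ht : t ∈ Set.Icc (0 : ℝ) (τ x)
    · have ht' : (x, t) ∈ {p : X × ℝ | 0 ≤ p.2 ∧ p.2 ≤ τ p.1} := ht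
      rw [Set.indicator_of_mem ht, Set.indicator_of_mem ht', ← flow_base_eq f τ x ht]
    · have ht' : (x, t) ∉ {p : X × ℝ | 0 ≤ p.2 ∧ p.2 ≤ τ p.1} := ht
      rw [Set.indicator_of_notMem ht, Set.indicator_of_notMem ht']
  simp_rw [e]
  refine (hτ.ennreal_ofReal.inv).mul (Measurable.lintegral_prod_right' (Measurable.indicator ?_ ?_))
  · exact (measurable_one.indicator hs).comp (continuous_clampMap f τ).measurable
  · exact (measurableSet_le measurable_const measurable_snd).inter
      (measurableSet_le measurable_snd (hτ.comp measurable_fst))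

theorem lintegral_lift (μ : Measure X) {h : Suspension f τ → ℝ≥0∞} (hh : Measurable h) :
    ∫⁻ y, h y ∂lift f τ μ = ∫⁻ x, ((ENNReal.ofReal (τ x : ℝ))⁻¹ *
      ∫⁻ t in Set.Icc (0 : ℝ) (τ x), h (flow f τ t (base f τ x))) ∂μ := by
  rw [lift, Measure.lintegral_bind (measurable_fiberMeasure f τ).aemeasurable hh.aemeasurable]
  simp_rw [lintegral_fiberMeasure f τ hh]

theorem lift_univ (μ : Measure X) : lift f τ μ Set.univ = μ Set.univ := by
  rw [← lintegral_one, lintegral_lift f τ μ measurable_const, ← lintegral_one]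
  refine lintegral_congr fun x => ?_
  have h : 0 < (τ x : ℝ) := (τ x).2
  simp [ENNReal.inv_mul_cancel (ENNReal.ofReal_pos.2 h).ne' ENNReal.ofReal_ne_top]

instance instIsProbabilityMeasureFiberMeasure (x : X) : IsProbabilityMeasure (fiberMeasure f τ x) := by
  have h : 0 < (τ x : ℝ) := (τ x).2
  constructor
  rw [← lintegral_one, lintegral_fiberMeasure f τ measurable_const]
  simp [ENNReal.inv_mul_cancel (ENNReal.ofReal_pos.2 h).ne' ENNReal.ofReal_ne_top]

instance instIsFiniteMeasureLift (μ : Measure X) [IsFiniteMeasure μ] :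
    IsFiniteMeasure (lift f τ μ) := ⟨by rw [lift_univ]; exact measure_lt_top μ _⟩

/-- The identity by which the lift of a finite measure is usually introduced. -/
theorem integral_lift (μ : Measure X) [IsFiniteMeasure μ] (h : C(Suspension f τ, ℝ)) :
    ∫ y, h y ∂lift f τ μ =
      ∫ x, (1 / (τ x : ℝ)) * (∫ t in (0 : ℝ)..(τ x), h (flow f τ t (base f τ x))) ∂μ := by
  obtain ⟨C, hC⟩ := isCompact_univ.exists_bound_of_continuousOn h.continuous.continuousOn
  have hi : Integrable h (lift f τ μ) :=
    Integrable.of_bound h.continuous.measurable.aestronglyMeasurable C (.of_forall fun y => hC y trivial)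
  let κ : ProbabilityTheory.Kernel X (Suspension f τ) :=
    ⟨fiberMeasure f τ, measurable_fiberMeasure f τ⟩
  have e := ProbabilityTheory.Kernel.integral_comp (κ := ProbabilityTheory.Kernel.const Unit μ)
    (η := κ) (a := ()) (f := h) hi
  refine e.trans (integral_congr_ae (.of_forall fun x => ?_))
  have hx : 0 < (τ x : ℝ) := (τ x).2
  change ∫ y, h y ∂fiberMeasure f τ x =
    1 / (τ x : ℝ) * ∫ t in (0 : ℝ)..(τ x), h (flow f τ t (base f τ x))
  rw [fiberMeasure, integral_smul_measure, integral_map (aemeasurable_flow_base f τ x)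
    h.continuous.measurable.aestronglyMeasurable, intervalIntegral.integral_of_le hx.le,
    integral_Icc_eq_integral_Ioc]
  simp [ENNReal.toReal_ofReal hx.le]

end Suspension

end Suspension

/-!
Distances in the suspension are infima over chains, and two facts about a chain of length `l`
control them from below. The height modulo `1` changes by at most `l` along it
(`Suspension.norm_height_sub_le_of_chain`); and if it starts at height about `1 / 2` and is short,
it never reaches the identification, so the base points of its ends are at distance at most `4 * l`
(`Suspension.exists_of_short_chain`).

If `μ` is expansive for `f`, the height `τ = 1` works. When `(y, s')` lies in a small flow ball
around `(x, s)`, with reparametrization `h`, the continuous function `t + s - (h t + s')` is always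
near an integer, hence near a fixed integer `k`. Comparing the two orbits whenever that of `x` is at
height `1 / 2` shows that the `f`-orbits of `y` and of `f ^ k x` stay close
(`Suspension.exists_mem_dynBall_of_mem_flowBall`). So the flow ball projects into a countable union
of dynamic balls of `f`, a null set, and its measurable subsets are null for the lift.

Conversely, let the lift be expansive for some `τ`. If the `f`-orbits of `x` and `y` stay close,
then running through the floors over both orbits at the same relative speed, which is a homeomorphic
change of time (`Suspension.roofTimeIso`), keeps the points of the suspension close, and a small
difference of relative heights does no harm (`Suspension.point_mem_flowBall`). Hence the box of
relative heights near `1 / 2` over a dynamic ball lies in a flow ball. The box is closed, as it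
avoids the identification, so it is null for the lift; every fiber over the dynamic ball meets it in
an interval of positive length, so the dynamic ball is null.
-/

namespace Suspension

variable {X : Type*} [MetricSpace X] (f : X ≃ₜ X) (τ : C(X, Set.Ioi (0 : ℝ)))

/-! ### Interior points of the suspension -/

open Classical in
/-- The coordinates `(x, t)` of a point of the suspension that lies strictly between floor and roof,
and `none` for the points of the base, where the identification takes place. -/
noncomputable def interiorCoord : Suspension f τ → Option (X × ℝ) :=
  Quot.lift (fun p : UnderRoof τ => if 0 < p.1.2 ∧ p.1.2 < τ p.1.1 then some p.1 else none) (by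
    rintro ⟨⟨x, s⟩, hs⟩ ⟨⟨y, u⟩, hu⟩ ⟨h1, h2⟩
    simp only [Prod.mk.injEq] at h1 h2
    obtain ⟨rfl, rfl⟩ := h2
    simp [h1])

theorem interiorCoord_mk_eq_some_iff (p : UnderRoof τ) (q : X × ℝ) :
    interiorCoord f τ (mk f τ p) = some q ↔ (0 < p.1.2 ∧ p.1.2 < τ p.1.1) ∧ p.1 = q := by
  change (if _ then _ else _) = some q ↔ _
  split_ifs with h <;> simp [h]

/-- A set of interior points that is closed under the roof and stays away from floor and roof is
closed in the suspension, since the quotient map is injective there. -/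
theorem isClosed_interiorCoord_preimage {C : Set (X × ℝ)} (hC : IsClosed C)
    (hC' : ∀ q ∈ C, 0 < q.2 ∧ q.2 < τ q.1) :
    IsClosed {z : Suspension f τ | ∃ q ∈ C, interiorCoord f τ z = some q} := by
  have hq : Topology.IsQuotientMap (mk f τ) := isQuotientMap_quot_mk
  rw [← hq.isClosed_preimage]
  have e : mk f τ ⁻¹' {z | ∃ q ∈ C, interiorCoord f τ z = some q} = Subtype.val ⁻¹' C := by
    ext p
    simp only [Set.mem_preimage, Set.mem_ofPred_eq, interiorCoord_mk_eq_some_iff]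
    constructor
    · rintro ⟨q, hq, -, rfl⟩
      exact hq
    · exact fun h => ⟨p.1, h, hC' _ h, rfl⟩
  rw [e]
  exact hC.preimage continuous_subtype_val

variable [CompactSpace X]

theorem exists_eq_point (z : Suspension f τ) : ∃ x s, z = point f τ x s := by
  induction z using Quot.ind with
  | mk p => exact ⟨p.1.1, p.1.2, mk_eq_point f τ p⟩

theorem interiorCoord_point {x : X} {s : ℝ} (h0 : 0 < s) (h1 : s < τ x) :
    interiorCoord f τ (point f τ x s) = some (x, s) := by
  rw [← mk_eq_point f τ ⟨(x, s), h0.le, h1.le⟩, interiorCoord_mk_eq_some_iff]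
  exact ⟨⟨h0, h1⟩, rfl⟩

theorem flow_base (x : X) (t : ℝ) : flow f τ t (base f τ x) = point f τ x t := by
  unfold base
  rw [flow_mk, add_zero]

/-! ### Reparametrization of the orbits -/

/-- The time at which the vertical orbit of `(x, 0)` has run through `u` floors, linear on each
floor: it takes the flow of height `1` to the flow of height `τ` along the orbit of `x`. -/
noncomputable def roofTime (x : X) (u : ℝ) : ℝ :=
  roofSum f τ x ⌊u⌋ + Int.fract u * τ ((f ^ ⌊u⌋) x)

omit [CompactSpace X] in
theorem roofTime_of_mem {x : X} {u : ℝ} (h0 : 0 ≤ u) (h1 : u < 1) :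
    roofTime f τ x u = u * τ x := by
  have h : ⌊u⌋ = 0 := Int.floor_eq_zero_iff.2 ⟨h0, h1⟩
  simp [roofTime, h, roofSum_zero, Int.fract]

omit [CompactSpace X] in
theorem roofTime_strictMono (x : X) : StrictMono (roofTime f τ x) := by
  intro u v huv
  have pos : ∀ z, 0 < (τ z : ℝ) := fun z => (τ z).2
  rcases (Int.floor_mono huv.le).eq_or_lt with h | h
  · have : Int.fract u < Int.fract v := by
      unfold Int.fract
      rw [h]
      linarith
    unfold roofTime
    rw [h]
    gcongr
    exact pos _
  · have h1 : roofTime f τ x u < roofSum f τ x (⌊u⌋ + 1) := by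
      rw [roofSum_succ]
      unfold roofTime
      have := mul_lt_mul_of_pos_right (Int.fract_lt_one u) (pos ((f ^ ⌊u⌋) x))
      linarith
    have h2 : roofSum f τ x (⌊u⌋ + 1) ≤ roofSum f τ x ⌊v⌋ :=
      (roofSum_strictMono f τ x).monotone h
    have h3 : roofSum f τ x ⌊v⌋ ≤ roofTime f τ x v :=
      le_add_of_nonneg_right (mul_nonneg (Int.fract_nonneg v) (pos _).le)
    linarith

theorem roofTime_surjective (x : X) : Function.Surjective (roofTime f τ x) := by
  intro t
  have pos : 0 < (τ ((f ^ lap f τ x t) x) : ℝ) := (τ _).2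
  have h1 := roofSum_lap_le f τ x t
  have h2 := lt_roofSum_lap f τ x t
  rw [roofSum_succ] at h2
  set n := lap f τ x t
  set r := (t - roofSum f τ x n) / τ ((f ^ n) x) with hr
  have hr0 : 0 ≤ r := div_nonneg (by linarith) pos.le
  have hr1 : r < 1 := (div_lt_one pos).2 (by linarith)
  have hf : ⌊(n : ℝ) + r⌋ = n := by
    rw [Int.floor_intCast_add, Int.floor_eq_zero_iff.2 ⟨hr0, hr1⟩, add_zero]
  refine ⟨n + r, ?_⟩
  unfold roofTime Int.fract
  rw [hf, add_sub_cancel_left, hr, div_mul_cancel₀ _ pos.ne']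
  ring

/-- `roofTime` as an order isomorphism of the line; a monotone bijection is a homeomorphism. -/
noncomputable def roofTimeIso (x : X) : ℝ ≃o ℝ :=
  (roofTime_strictMono f τ x).orderIsoOfSurjective _ (roofTime_surjective f τ x)

theorem roofTimeIso_apply (x : X) (u : ℝ) : roofTimeIso f τ x u = roofTime f τ x u := rfl

omit [CompactSpace X] in
theorem roofSum_unitRoof (x : X) (n : ℤ) : roofSum f (unitRoof X) x n = n := by
  have h1 : ∀ z, ((unitRoof X) z : ℝ) = 1 := fun _ => rfl
  induction n using Int.induction_on with
  | zero => simp [roofSum_zero]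
  | succ i ih => rw [roofSum_succ, ih, h1]; push_cast; ring
  | pred i ih =>
    have h := roofSum_succ f (unitRoof X) x (-(i : ℤ) - 1)
    rw [sub_add_cancel, ih, h1] at h
    push_cast at h ⊢
    linarith

theorem point_unitRoof_zpow (x : X) (n : ℤ) (s : ℝ) :
    point f (unitRoof X) ((f ^ n) x) s = point f (unitRoof X) x (s + n) := by
  rw [point_zpow, roofSum_unitRoof]

theorem toUnit_point {x : X} {s : ℝ} (h0 : 0 ≤ s) (h1 : s ≤ τ x) :
    toUnit f τ (point f τ x s) = point f (unitRoof X) x (s / τ x) := by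
  rw [← mk_eq_point f τ ⟨(x, s), h0, h1⟩]
  exact mk_eq_point f (unitRoof X) _

theorem toUnit_point_roofTime (x : X) (u : ℝ) :
    toUnit f τ (point f τ x (roofTime f τ x u)) = point f (unitRoof X) x u := by
  have pos : 0 < (τ ((f ^ ⌊u⌋) x) : ℝ) := (τ _).2
  have h1 := mul_le_mul_of_nonneg_right (Int.fract_lt_one u).le pos.le
  rw [roofTime, add_comm, ← point_zpow,
    toUnit_point f τ (mul_nonneg (Int.fract_nonneg u) pos.le) (by linarith),
    mul_div_cancel_right₀ _ pos.ne', point_unitRoof_zpow, Int.fract_add_floor]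

omit [CompactSpace X] in
theorem toUnit_unitRoof (z : Suspension f (unitRoof X)) : toUnit f (unitRoof X) z = z := by
  induction z using Quot.ind with
  | mk p =>
    change mk f (unitRoof X) _ = mk f (unitRoof X) p
    congr 1
    exact Subtype.ext (Prod.ext rfl (div_one _))

/-! ### The Bowen-Walters metric -/

omit [CompactSpace X] in
theorem normDist_nonneg (x y : X) : 0 ≤ normDist x y :=
  div_nonneg dist_nonneg Metric.diam_nonneg

/-- This holds for diameter `0` too, where `normDist` vanishes by division by zero. -/
theorem normDist_mul_diam (x y : X) :
    normDist x y * Metric.diam (Set.univ : Set X) = dist x y := by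
  have h := Metric.dist_le_diam_of_mem isCompact_univ.isBounded (Set.mem_univ x) (Set.mem_univ y)
  rcases eq_or_ne (Metric.diam (Set.univ : Set X)) 0 with h0 | h0
  · rw [h0] at h ⊢
    linarith [dist_nonneg (x := x) (y := y)]
  · exact div_mul_cancel₀ _ h0

omit [CompactSpace X] in
theorem horizontal_length_nonneg (x x' : X) {t : ℝ} (h0 : 0 ≤ t) (h1 : t ≤ 1) :
    0 ≤ (1 - t) * normDist x x' + t * normDist (f x) (f x') :=
  add_nonneg (mul_nonneg (by linarith) (normDist_nonneg _ _))
    (mul_nonneg h0 (normDist_nonneg _ _))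

theorem Chain.length_nonneg {y z : Suspension f (unitRoof X)} {l : ℝ} (c : Chain f y z l) :
    0 ≤ l := by
  induction c with
  | nil => exact le_rfl
  | horizontal x x' t h0 h1 z l c ih => exact add_nonneg (horizontal_length_nonneg f x x' h0 h1) ih
  | vertical y r z l c ih => exact add_nonneg (abs_nonneg r) ih

/-- Two orbit points are joined by one horizontal and one vertical segment. -/
theorem exists_chain_point (x y : X) (u v : ℝ) :
    Chain f (point f (unitRoof X) x u) (point f (unitRoof X) y v)
      ((1 - Int.fract u) * normDist ((f ^ ⌊u⌋) x) ((f ^ ⌊u⌋) y) +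
        Int.fract u * normDist ((f ^ (⌊u⌋ + 1)) x) ((f ^ (⌊u⌋ + 1)) y) + (|v - u| + 0)) := by
  have e : ∀ w : X, mk f (unitRoof X) ⟨((f ^ ⌊u⌋) w, Int.fract u), Int.fract_nonneg u,
      (Int.fract_lt_one u).le⟩ = point f (unitRoof X) w u := by
    intro w
    rw [mk_eq_point, point_unitRoof_zpow, Int.fract_add_floor]
  have e' : ∀ w : X, (f ^ (⌊u⌋ + 1)) w = f ((f ^ ⌊u⌋) w) := by
    intro w
    rw [add_comm, zpow_add, zpow_one]
    rfl
  rw [← e x, e', e']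
  refine Chain.horizontal _ _ _ (Int.fract_nonneg u) (Int.fract_lt_one u).le _ _
    (Chain.vertical _ (v - u) _ _ ?_)
  rw [e y, flow_point, sub_add_cancel]
  exact Chain.nil _

theorem exists_chain (y z : Suspension f (unitRoof X)) : ∃ l, Chain f y z l := by
  obtain ⟨x, u, rfl⟩ := exists_eq_point f _ y
  obtain ⟨x', v, rfl⟩ := exists_eq_point f _ z
  exact ⟨_, exists_chain_point f x x' u v⟩

theorem exists_chain_lt {y z : Suspension f (unitRoof X)} {r : ℝ} (h : unitDist f y z < r) :
    ∃ l < r, Chain f y z l := by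
  obtain ⟨l, hl, hr⟩ := exists_lt_of_csInf_lt (exists_chain f y z) h
  exact ⟨l, hr, hl⟩

/-- If the whole orbits of `x` and `y` are close then so are their orbits in the suspension. -/
theorem unitDist_point_le {x y : X} {r : ℝ} (h : ∀ n : ℤ, normDist ((f ^ n) x) ((f ^ n) y) ≤ r)
    (u v : ℝ) : unitDist f (point f (unitRoof X) x u) (point f (unitRoof X) y v) ≤ r + |v - u| := by
  refine (csInf_le ⟨0, fun l hl => Chain.length_nonneg f hl⟩ (exists_chain_point f x y u v)).trans ?_
  have h1 := mul_le_mul_of_nonneg_left (h ⌊u⌋) (sub_nonneg.2 (Int.fract_lt_one u).le)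
  have h2 := mul_le_mul_of_nonneg_left (h (⌊u⌋ + 1)) (Int.fract_nonneg u)
  linarith

/-- The height of a point of the suspension with roof `1`, modulo `1`. -/
noncomputable def height : Suspension f (unitRoof X) → UnitAddCircle :=
  Quot.lift (fun p => ((p.1.2 : ℝ) : UnitAddCircle)) (by
    rintro ⟨⟨x, s⟩, hs⟩ ⟨⟨y, u⟩, hu⟩ ⟨h1, h2⟩
    simp only [Prod.mk.injEq] at h1 h2
    obtain ⟨rfl, rfl⟩ := h2
    have h1' : s = 1 := h1
    simp only [h1', AddCircle.coe_period]
    simp)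

theorem height_point (x : X) (s : ℝ) :
    height f (point f (unitRoof X) x s) = (s : UnitAddCircle) := by
  change ((s - roofSum f (unitRoof X) x (lap f (unitRoof X) x s) : ℝ) : UnitAddCircle) = _
  rw [roofSum_unitRoof, ← sub_eq_zero, ← AddCircle.coe_sub, AddCircle.coe_eq_zero_iff]
  exact ⟨-lap f (unitRoof X) x s, by simp⟩

theorem norm_height_sub_le_of_chain {y z : Suspension f (unitRoof X)} {l : ℝ}
    (c : Chain f y z l) : ‖height f y - height f z‖ ≤ l := by
  induction c with
  | nil => simp
  | horizontal x x' t h0 h1 z l c ih =>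
    exact ih.trans (le_add_of_nonneg_left (horizontal_length_nonneg f x x' h0 h1))
  | vertical y r z l c ih =>
    have h : ‖height f y - height f (flow f (unitRoof X) r y)‖ ≤ |r| := by
      obtain ⟨x, s, rfl⟩ := exists_eq_point f _ y
      rw [flow_point, height_point, height_point, ← AddCircle.coe_sub, sub_add_cancel_right,
        UnitAddCircle.norm_eq]
      have := round_le (-r) 0
      simpa using this
    exact (norm_sub_le_norm_sub_add_norm_sub _ _ _).trans (add_le_add h ih)

/-- A chain that starts at height about `1 / 2` and is shorter than the way to the heights `1 / 4`
and `3 / 4` never meets the identification, and all its horizontal segments have at least a quarter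
of their length in the base. -/
theorem exists_of_short_chain {y z : Suspension f (unitRoof X)} {l : ℝ} (c : Chain f y z l)
    {x : X} {a : ℝ} (hy : y = point f (unitRoof X) x a) (h0 : 1 / 4 ≤ a - l) (h1 : a + l ≤ 3 / 4) :
    ∃ x' b, z = point f (unitRoof X) x' b ∧ |a - b| ≤ l ∧ normDist x x' ≤ 4 * l := by
  induction c generalizing x a with
  | nil y => exact ⟨x, a, hy, by simp, by simp [normDist]⟩
  | horizontal w w' t ht0 ht1 z l c ih =>
    have hl := Chain.length_nonneg f c
    have hlen := horizontal_length_nonneg f w w' ht0 ht1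
    have hi := interiorCoord_point f (unitRoof X) (x := x) (s := a) (by linarith)
      (show a < 1 by linarith)
    rw [← hy, interiorCoord_mk_eq_some_iff, Prod.mk.injEq] at hi
    obtain ⟨-, rfl, rfl⟩ := hi
    obtain ⟨x', b, hz, hab, hd⟩ := ih (mk_eq_point f (unitRoof X) _) (by linarith) (by linarith)
    refine ⟨x', b, hz, by linarith, ?_⟩
    have tri : normDist w x' ≤ normDist w w' + normDist w' x' := by
      unfold normDist
      rw [← add_div]
      exact div_le_div_of_nonneg_right (dist_triangle _ _ _) Metric.diam_nonneg
    have h3 : 1 / 4 * normDist w w' ≤ (1 - t) * normDist w w' :=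
      mul_le_mul_of_nonneg_right (by linarith) (normDist_nonneg _ _)
    have h4 := mul_nonneg ht0 (normDist_nonneg (f w) (f w'))
    linarith
  | vertical y r z l c ih =>
    have hr := abs_le.1 (le_refl |r|)
    obtain ⟨x', b, hz, hab, hd⟩ := ih (x := x) (a := r + a) (by rw [hy, flow_point])
      (by linarith) (by linarith)
    refine ⟨x', b, hz, ?_, by linarith [abs_nonneg r]⟩
    rw [abs_le] at hab ⊢
    constructor <;> linarith

/-! ### Expansivity of the measure and of its lift -/

/-- Points in the same flow ball for height `1` have base points whose orbits, after
a shift, stay close: the reparametrization differs from the identity by almost an integer. -/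
theorem exists_mem_dynBall_of_mem_flowBall {δ : ℝ} (hδ : δ ≤ 1 / 16) (h0 : 0 < δ) {x y : X}
    {s s' : ℝ}
    (h : point f (unitRoof X) y s' ∈ flowBall (flow f (unitRoof X)) δ (point f (unitRoof X) x s)) :
    ∃ k : ℤ, y ∈ dynBall f (8 * δ * Metric.diam (Set.univ : Set X)) ((f ^ k) x) := by
  obtain ⟨h, hc, hh0, hd⟩ := h
  have hd' : ∀ t, unitDist f (point f (unitRoof X) x (t + s))
      (point f (unitRoof X) y (h t + s')) < 2 * δ := by
    intro t
    have := hd t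
    rw [flow_point, flow_point] at this
    change unitDist f (toUnit f _ _) (toUnit f _ _) ≤ δ at this
    rw [toUnit_unitRoof, toUnit_unitRoof] at this
    linarith
  set g : ℝ → ℝ := fun t => (t + s) - (h t + s') with hg
  have hgc : Continuous g := by fun_prop
  have hgr : ∀ t, |g t - round (g t)| < 2 * δ := by
    intro t
    obtain ⟨l, hl, c⟩ := exists_chain_lt f (hd' t)
    have := norm_height_sub_le_of_chain f c
    rw [height_point, height_point, ← AddCircle.coe_sub, UnitAddCircle.norm_eq] at this
    exact this.trans_lt hl
  set k := round (g 0) with hk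
  -- `g` cannot get at distance `1 / 2` from `k`, as it would be far from all integers there
  have hgk : ∀ t, |g t - k| < 2 * δ := by
    have lt_half : ∀ t, |g t - k| < 1 / 2 := by
      intro t
      by_contra! hcon
      obtain ⟨t', ht'⟩ := mem_range_of_exists_le_of_exists_ge
        (f := fun t => |g t - k|) (by fun_prop) ⟨0, by linarith [hgr 0]⟩ ⟨t, hcon⟩
      have h1 := hgr t'
      have h2 : (1 : ℝ) / 2 ≤ |g t' - round (g t')| := by
        rcases eq_or_ne (round (g t')) k with e | e
        · rw [e]
          exact ht'.ge
        · have h3 : (1 : ℝ) ≤ |(round (g t') : ℝ) - k| := by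
            exact_mod_cast Int.one_le_abs (sub_ne_zero.2 e)
          have h4 := abs_sub_le (round (g t') : ℝ) (g t') k
          have h5 : |g t' - k| = 1 / 2 := ht'
          rw [abs_sub_comm _ (g t')] at h4
          linarith
      linarith
    intro t
    have e : round (g t) = k := by
      by_contra e
      have h3 : (1 : ℝ) ≤ |(round (g t) : ℝ) - k| := by
        exact_mod_cast Int.one_le_abs (sub_ne_zero.2 e)
      have h4 := abs_sub_le (round (g t) : ℝ) (g t) k
      rw [abs_sub_comm _ (g t)] at h4
      linarith [lt_half t, hgr t]
    rw [← e]
    exact hgr t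
  refine ⟨k, fun n => ?_⟩
  -- at this time the orbit of `x` is at height `1 / 2` over `f ^ (n + k) x`
  obtain ⟨t, ht⟩ : ∃ t : ℝ, t + s = 1 / 2 + ((n + k : ℤ) : ℝ) :=
    ⟨1 / 2 + ((n + k : ℤ) : ℝ) - s, by ring⟩
  have hgt := hgk t
  obtain ⟨l, hl, c⟩ := exists_chain_lt f (hd' t)
  rw [abs_lt, hg] at hgt
  push_cast at ht
  obtain ⟨b, hb⟩ : ∃ b : ℝ, h t + s' = b + n := ⟨h t + s' - n, by ring⟩
  have hx : point f (unitRoof X) x (t + s) = point f (unitRoof X) ((f ^ (n + k)) x) (1 / 2) := by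
    rw [point_unitRoof_zpow, ht, Int.cast_add]
  obtain ⟨y', b', hy', hb', hdist⟩ := exists_of_short_chain f c hx (by linarith) (by linarith)
  rw [hb, ← point_unitRoof_zpow] at hy'
  rw [abs_le] at hb'
  have e := congrArg (interiorCoord f (unitRoof X)) hy'
  have e1 : (unitRoof X ((f ^ n) y) : ℝ) = 1 := rfl
  have e2 : (unitRoof X y' : ℝ) = 1 := rfl
  rw [interiorCoord_point f _ (by linarith) (by linarith),
    interiorCoord_point f _ (by linarith) (by linarith), Option.some_inj, Prod.mk.injEq] at e
  rw [← e.1] at hdist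
  rw [show (f ^ n) ((f ^ k) x) = (f ^ (n + k)) x by rw [zpow_add]; rfl, ← normDist_mul_diam]
  exact mul_le_mul_of_nonneg_right (by linarith) Metric.diam_nonneg

/-- Over the dynamic ball of `x`, the points whose relative height is near `1 / 2` lie in the
flow ball around the point over `x` with relative height `1 / 2`. -/
theorem point_mem_flowBall {δ ε : ℝ} {x y : X}
    (hε : ε ≤ δ / 2 * Metric.diam (Set.univ : Set X) ∨ Metric.diam (Set.univ : Set X) = 0)
    (hδ : 0 < δ) (hy : y ∈ dynBall f ε x) {b : ℝ} (hb : |b - 1 / 2| ≤ δ / 2) :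
    point f τ y (roofTime f τ y b) ∈
      flowBall (flow f τ) δ (point f τ x (roofTime f τ x (1 / 2))) := by
  have hn : ∀ n : ℤ, normDist ((f ^ n) x) ((f ^ n) y) ≤ δ / 2 := by
    intro n
    rcases hε with h | h
    · exact div_le_of_le_mul₀ Metric.diam_nonneg (by linarith) ((hy n).trans h)
    · simp only [normDist, h, div_zero]
      linarith
  refine ⟨fun t => roofTimeIso f τ y
    ((roofTimeIso f τ x).symm (t + roofTime f τ x (1 / 2)) + (b - 1 / 2)) - roofTime f τ y b,
    ?_, ?_, fun t => ?_⟩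
  · exact (((roofTimeIso f τ y).continuous.comp (((roofTimeIso f τ x).symm.continuous.comp
      (continuous_id.add continuous_const)).add continuous_const))).sub continuous_const
  · simp only [zero_add]
    rw [← roofTimeIso_apply f τ x, OrderIso.symm_apply_apply, ← roofTimeIso_apply f τ y,
      add_sub_cancel, sub_self]
  · obtain ⟨u, hu⟩ := (roofTimeIso f τ x).surjective (t + roofTime f τ x (1 / 2))
    beta_reduce
    rw [flow_point, flow_point, ← hu, OrderIso.symm_apply_apply, sub_add_cancel]
    change unitDist f (toUnit f τ _) (toUnit f τ _) ≤ δ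
    rw [roofTimeIso_apply, roofTimeIso_apply, toUnit_point_roofTime, toUnit_point_roofTime]
    refine (unitDist_point_le f hn _ _).trans ?_
    rw [add_sub_cancel_left]
    linarith

omit [CompactSpace X] in
theorem isClosed_dynBall (δ : ℝ) (x : X) : IsClosed (dynBall f δ x) := by
  unfold dynBall
  rw [Set.ofPred_forall]
  exact isClosed_iInter fun n => isClosed_le (continuous_const.dist (f ^ n).continuous)
    continuous_const

variable [MeasurableSpace X] [BorelSpace X]

theorem lift_eq_zero_iff (μ : Measure X) {A : Set (Suspension f τ)} (hA : MeasurableSet A) :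
    lift f τ μ A = 0 ↔ ∀ᵐ y ∂μ, fiberMeasure f τ y A = 0 := by
  rw [lift, Measure.bind_apply hA (measurable_fiberMeasure f τ).aemeasurable]
  exact lintegral_eq_zero_iff ((Measure.measurable_coe hA).comp (measurable_fiberMeasure f τ))

omit [MeasurableSpace X] [BorelSpace X] in
/-- The fiber measure is carried by the orbit segment over its base point, and is a positive
multiple of Lebesgue measure there. -/
theorem fiberMeasure_eq_zero_iff {A : Set (Suspension f τ)} (hA : MeasurableSet A) (y : X) :
    fiberMeasure f τ y A = 0 ↔
      volume.restrict (Set.Icc (0 : ℝ) (τ y)) {t | point f τ y t ∈ A} = 0 := by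
  rw [fiberMeasure, Measure.smul_apply, Measure.map_apply_of_aemeasurable
    (aemeasurable_flow_base f τ y) hA, smul_eq_mul, mul_eq_zero]
  simp only [ENNReal.inv_eq_zero, ENNReal.ofReal_ne_top, false_or, flow_base, Set.preimage]

theorem isFlowExpansiveMeasure_lift_unitRoof {μ : Measure X} (h : IsExpansiveMeasure f μ) :
    IsFlowExpansiveMeasure (flow f (unitRoof X)) (lift f (unitRoof X) μ) := by
  obtain ⟨ε, hε, hnull⟩ := h
  obtain ⟨δ, hδ0, hδ1, hδ⟩ : ∃ δ : ℝ, 0 < δ ∧ δ ≤ 1 / 16 ∧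
      8 * δ * Metric.diam (Set.univ : Set X) ≤ ε := by
    have hD : 0 ≤ Metric.diam (Set.univ : Set X) := Metric.diam_nonneg
    refine ⟨min (1 / 16) (ε / (8 * (Metric.diam (Set.univ : Set X) + 1))), by positivity,
      min_le_left _ _, ?_⟩
    have h1 := min_le_right (1 / 16) (ε / (8 * (Metric.diam (Set.univ : Set X) + 1)))
    rw [le_div_iff₀ (by positivity)] at h1
    refine le_trans ?_ h1
    have : 0 < min (1 / 16) (ε / (8 * (Metric.diam (Set.univ : Set X) + 1))) := by positivity
    nlinarith
  refine ⟨δ, hδ0, fun z A hA hAz => ?_⟩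
  obtain ⟨x, s, rfl⟩ := exists_eq_point f _ z
  rw [lift_eq_zero_iff f _ μ hA]
  have hN : μ (⋃ k : ℤ, dynBall f ε ((f ^ k) x)) = 0 :=
    measure_iUnion_null fun k => hnull _ _ (isClosed_dynBall f ε _).measurableSet subset_rfl
  filter_upwards [measure_eq_zero_iff_ae_notMem.1 hN] with y hy
  rw [fiberMeasure_eq_zero_iff f _ hA]
  suffices h : {t | point f (unitRoof X) y t ∈ A} = ∅ by rw [h, measure_empty]
  refine Set.eq_empty_of_forall_notMem fun t ht => hy ?_
  obtain ⟨k, hk⟩ := exists_mem_dynBall_of_mem_flowBall f hδ1 hδ0 (hAz ht)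
  exact Set.mem_iUnion.2 ⟨k, fun n => (hk n).trans hδ⟩

theorem isExpansiveMeasure_of_lift {μ : Measure X}
    (h : IsFlowExpansiveMeasure (flow f τ) (lift f τ μ)) : IsExpansiveMeasure f μ := by
  obtain ⟨δ, hδ, hnull⟩ := h
  obtain ⟨ε, hε0, hε⟩ : ∃ ε : ℝ, 0 < ε ∧ (ε ≤ δ / 2 * Metric.diam (Set.univ : Set X) ∨
      Metric.diam (Set.univ : Set X) = 0) := by
    rcases (Metric.diam_nonneg (s := (Set.univ : Set X))).eq_or_lt with h | h
    · exact ⟨1, one_pos, .inr h.symm⟩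
    · exact ⟨_, by positivity, .inl le_rfl⟩
  obtain ⟨η, hη0, hη1, hη⟩ : ∃ η : ℝ, 0 < η ∧ η ≤ 1 / 4 ∧ η ≤ δ / 2 :=
    ⟨min (1 / 4) (δ / 2), by positivity, min_le_left _ _, min_le_right _ _⟩
  refine ⟨ε, hε0, fun x B _ hB => measure_mono_null hB ?_⟩
  -- the box over the dynamic ball, of relative heights between `1 / 2 - η` and `1 / 2 + η`
  set C : Set (X × ℝ) := {q | q.1 ∈ dynBall f ε x ∧ |q.2 - 1 / 2 * τ q.1| ≤ η * τ q.1} with hC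
  have hCc : IsClosed C := by
    have h : IsClosed {q : X × ℝ | |q.2 - 1 / 2 * τ q.1| ≤ η * τ q.1} :=
      isClosed_le (by fun_prop) (by fun_prop)
    exact ((isClosed_dynBall f ε x).preimage continuous_fst).inter h
  have hC' : ∀ q ∈ C, 0 < q.2 ∧ q.2 < τ q.1 := by
    rintro ⟨y, t⟩ ⟨-, ht⟩
    have pos : 0 < (τ y : ℝ) := (τ y).2
    have := mul_le_mul_of_nonneg_right hη1 pos.le
    simp only [abs_le] at ht ⊢
    constructor <;> linarith
  have hA := (isClosed_interiorCoord_preimage f τ hCc hC').measurableSet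
  have h0 := hnull (point f τ x (roofTime f τ x (1 / 2))) _ hA (by
    rintro z ⟨⟨y, t⟩, hq, hz⟩
    have pos : 0 < (τ y : ℝ) := (τ y).2
    obtain ⟨ht0, ht1⟩ := hC' _ hq
    have hz' : z = point f τ y t := by
      induction z using Quot.ind with
      | mk p =>
        obtain ⟨-, hp⟩ := (interiorCoord_mk_eq_some_iff f τ p (y, t)).1 hz
        have := mk_eq_point f τ p
        rw [hp] at this
        exact this
    have ht : t = roofTime f τ y (t / τ y) := by
      rw [roofTime_of_mem f τ (by positivity) ((div_lt_one pos).2 ht1), div_mul_cancel₀ _ pos.ne']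
    rw [hz', ht]
    refine point_mem_flowBall f τ hε hδ hq.1 (le_trans ?_ hη)
    have h2 := hq.2
    rw [show t / τ y - 1 / 2 = (t - 1 / 2 * τ y) / τ y by field_simp, abs_div, abs_of_pos pos,
      div_le_iff₀ pos]
    exact h2)
  rw [lift_eq_zero_iff f τ μ hA] at h0
  rw [measure_eq_zero_iff_ae_notMem]
  filter_upwards [h0] with y hy hyD
  have pos : 0 < (τ y : ℝ) := (τ y).2
  rw [fiberMeasure_eq_zero_iff f τ hA] at hy
  have hsub : Set.Icc ((1 / 2 - η) * τ y) ((1 / 2 + η) * τ y) ⊆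
      {t | point f τ y t ∈ {z | ∃ q ∈ C, interiorCoord f τ z = some q}} ∩ Set.Icc 0 (τ y : ℝ) := by
    intro t ht
    have hq : (y, t) ∈ C := ⟨hyD, by
      simp only [abs_le]
      constructor <;> linarith [ht.1, ht.2]⟩
    obtain ⟨ht0, ht1⟩ := hC' _ hq
    exact ⟨⟨_, hq, interiorCoord_point f τ ht0 ht1⟩, ht0.le, ht1.le⟩
  rw [Measure.restrict_apply₀' measurableSet_Icc.nullMeasurableSet] at hy
  have := measure_mono_null hsub hy
  rw [Real.volume_Icc, ENNReal.ofReal_eq_zero] at this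
  nlinarith [mul_pos hη0 pos]

end Suspension

theorem mainTheorem4 {X : Type*} [MetricSpace X] [CompactSpace X] [MeasurableSpace X] [BorelSpace X]
    (f : X ≃ₜ X) (μ : Measure X) :
    IsExpansiveMeasure f μ ↔
      ∃ τ : C(X, Set.Ioi (0 : ℝ)),
        IsFlowExpansiveMeasure (Suspension.flow f τ) (Suspension.lift f τ μ) :=
  ⟨fun h => ⟨_, Suspension.isFlowExpansiveMeasure_lift_unitRoof f h⟩,
    fun ⟨τ, h⟩ => Suspension.isExpansiveMeasure_of_lift f τ h⟩
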